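/- Let $(F,g_F)$ be a connected smooth ($C^\infty$) Riemannian manifold without boundary, of dimension $s$, let $f\colon F\to(0,\infty)$ be a smooth function, and let $I=(t_1,t_2)\subseteq\mathbb R$ be an open interval, $-\infty\le t_1<t_2\le\infty$. Let $I_f\times F$ be the standard static space-time, that is, the product manifold $I\times F$ with the Lorentzian metric $g=-f^2\,\mathrm dt^2\oplus g_F$. A smooth vector field $X$ on a semi-Riemannian manifold $(N,g_N)$ is called Killing if $\mathrm L_X g_N=0$, where $\mathrm L_X$ is the Lie derivative. Suppose that the only Killing vector field on $(F,g_F)$ is the zero vector field. Then the Killing vector fields on $I_f\times F$ are exactly the vector fields $h_0\,\partial_t$ with $h_0\in\mathbb R$ a constant. -/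

import Mathlib

open scoped Manifold ContDiff

noncomputable section

section Killing

variable {E : Type*} [NormedAddCommGroup E] [NormedSpace ℝ E]
  {H : Type*} [TopologicalSpace H] (I : ModelWithCorners ℝ E H)
  {N : Type*} [TopologicalSpace N] [ChartedSpace H N]

/-- A vector field on `N` is smooth: it is a `C^∞` section of the tangent bundle. -/
def IsSmoothVectorField [IsManifold I ∞ N] (X : ∀ x : N, TangentSpace I x) : Prop :=
  ContMDiff I I.tangent ∞ (fun x => (⟨x, X x⟩ : TangentBundle I N))

/-- The derivative `X φ` of a real function `φ` along the vector field `X`. -/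
def derivAlong (X : ∀ x : N, TangentSpace I x) (φ : N → ℝ) (x : N) : ℝ :=
  mfderiv I 𝓘(ℝ, ℝ) φ x (X x)

/-- The Lie derivative of a `(0,2)`-tensor field `g` along `X`, evaluated on vector fields:
`(L_X g)(Y, Z) = X (g (Y, Z)) - g ([X, Y], Z) - g (Y, [X, Z])`. -/
def lieDerivTensor (g : ∀ x : N, TangentSpace I x →L[ℝ] TangentSpace I x →L[ℝ] ℝ)
    (X Y Z : ∀ x : N, TangentSpace I x) (x : N) : ℝ :=
  derivAlong I X (fun y : N => g y (Y y) (Z y)) x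
    - g x (VectorField.mlieBracket I X Y x) (Z x)
    - g x (Y x) (VectorField.mlieBracket I X Z x)

/-- A smooth vector field `X` is a Killing field of the (semi-Riemannian) metric tensor `g`
if `L_X g = 0`. -/
def IsKillingField [IsManifold I ∞ N]
    (g : ∀ x : N, TangentSpace I x →L[ℝ] TangentSpace I x →L[ℝ] ℝ)
    (X : ∀ x : N, TangentSpace I x) : Prop :=
  IsSmoothVectorField I X ∧
    ∀ Y Z : ∀ x : N, TangentSpace I x, IsSmoothVectorField I Y → IsSmoothVectorField I Z →
      ∀ x : N, lieDerivTensor I g X Y Z x = 0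

end Killing

/-- The open interval `(t₁, t₂)` of `ℝ`, with possibly infinite end points. -/
def openInterval (t₁ t₂ : EReal) : TopologicalSpace.Opens ℝ :=
  ⟨{t : ℝ | t₁ < (t : EReal) ∧ (t : EReal) < t₂},
    (isOpen_lt continuous_const continuous_coe_real_ereal).inter
      (isOpen_lt continuous_coe_real_ereal continuous_const)⟩

section StaticSpacetime

variable {s : ℕ} {F : Type*} [TopologicalSpace F] [ChartedSpace (EuclideanSpace ℝ (Fin s)) F]

/-- The model with corners of the product manifold `J × F`, where `J` is an open subset
of `ℝ` and `F` is an `s`-dimensional manifold without boundary. -/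
abbrev staticModel (s : ℕ) : ModelWithCorners ℝ (ℝ × EuclideanSpace ℝ (Fin s))
    (ModelProd ℝ (EuclideanSpace ℝ (Fin s))) :=
  𝓘(ℝ, ℝ).prod (𝓡 s)

/-- The one-form `dt` on `J × F`: the differential of the coordinate function `(t, x) ↦ t`. -/
def staticDt (J : TopologicalSpace.Opens ℝ) (p : J × F) :
    TangentSpace (staticModel s) p →L[ℝ] ℝ :=
  mfderiv (staticModel s) 𝓘(ℝ, ℝ) (fun q : J × F => (q.1 : ℝ)) p

/-- The differential of the projection `J × F → F`. -/
def staticDproj (J : TopologicalSpace.Opens ℝ) (p : J × F) :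
    TangentSpace (staticModel s) p →L[ℝ] TangentSpace (𝓡 s) p.2 :=
  mfderiv (staticModel s) (𝓡 s) (Prod.snd : J × F → F) p

/-- The coordinate vector field `∂_t` on `J × F`. -/
def staticPartialT (J : TopologicalSpace.Opens ℝ) (p : J × F) : TangentSpace (staticModel s) p :=
  ((1 : ℝ), (0 : EuclideanSpace ℝ (Fin s)))

/-- The metric tensor `-f² dt² ⊕ g_F` of the standard static space-time `J_f × F`:
`g_{(t,x)}(u, v) = -f(x)² dt(u) dt(v) + g_F(dσ u, dσ v)`, with `σ : J × F → F` the projection. -/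
def staticMetric [IsManifold (𝓡 s) ∞ F] (J : TopologicalSpace.Opens ℝ) (f : F → ℝ)
    (gF : Bundle.ContMDiffRiemannianMetric (𝓡 s) ∞ (EuclideanSpace ℝ (Fin s))
      (fun x : F => TangentSpace (𝓡 s) x)) (p : J × F) :
    TangentSpace (staticModel s) p →L[ℝ] TangentSpace (staticModel s) p →L[ℝ] ℝ :=
  -(f p.2) ^ 2 • (staticDt J p).smulRight (staticDt J p)
    + (ContinuousLinearMap.precomp ℝ (staticDproj J p)).comp ((gF.inner p.2).comp (staticDproj J p))

theorem staticDproj_apply (J : TopologicalSpace.Opens ℝ) (p : J × F)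
    (v : TangentSpace (staticModel s) p) :
    staticDproj J p v = Prod.snd (α := ℝ) (β := EuclideanSpace ℝ (Fin s)) v := by
  unfold staticDproj
  rw [mfderiv_snd]
  rfl

theorem hasMFDerivAt_opens_coe (J : TopologicalSpace.Opens ℝ) (t : J) :
    HasMFDerivAt 𝓘(ℝ, ℝ) 𝓘(ℝ, ℝ) (fun q : J => (q : ℝ)) t (ContinuousLinearMap.id ℝ ℝ) := by
  refine ⟨continuous_subtype_val.continuousAt, ?_⟩
  have h : writtenInExtChartAt 𝓘(ℝ, ℝ) 𝓘(ℝ, ℝ) t (fun q : J => (q : ℝ))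
      =ᶠ[nhds (t : ℝ)] id := by
    have h0 := J.chartAt_subtype_val_symm_eventuallyEq (H := ℝ) (x := t)
    filter_upwards [h0] with y hy
    exact hy.symm
  have h' := (hasFDerivAt_id (𝕜 := ℝ) (t : ℝ)).congr_of_eventuallyEq h
  exact h'.hasFDerivWithinAt

theorem staticDt_apply (J : TopologicalSpace.Opens ℝ) (p : J × F)
    (v : TangentSpace (staticModel s) p) :
    staticDt J p v = Prod.fst (α := ℝ) (β := EuclideanSpace ℝ (Fin s)) v := by
  have h := (hasMFDerivAt_opens_coe J p.1).comp p
    (hasMFDerivAt_fst (I := 𝓘(ℝ, ℝ)) (I' := 𝓡 s) (x := p))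
  have h2 := h.mfderiv
  unfold staticDt
  erw [h2]
  rfl

theorem staticMetric_apply [IsManifold (𝓡 s) ∞ F] (J : TopologicalSpace.Opens ℝ) (f : F → ℝ)
    (gF : Bundle.ContMDiffRiemannianMetric (𝓡 s) ∞ (EuclideanSpace ℝ (Fin s))
      (fun x : F => TangentSpace (𝓡 s) x)) (p : J × F) (u v : TangentSpace (staticModel s) p) :
    staticMetric J f gF p u v = -(f p.2) ^ 2 * (staticDt J p u * staticDt J p v)
      + gF.inner p.2 (staticDproj J p u) (staticDproj J p v) := by
  simp [staticMetric]

theorem staticDt_partialT (J : TopologicalSpace.Opens ℝ) (p : J × F) :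
    staticDt (s := s) J p (staticPartialT J p) = 1 :=
  staticDt_apply J p _

theorem staticDproj_partialT (J : TopologicalSpace.Opens ℝ) (p : J × F) :
    staticDproj (s := s) J p (staticPartialT J p) = 0 :=
  staticDproj_apply J p _

end StaticSpacetime

end

/-! Write a Killing field as `K = h ∂_t + V`, with `V` tangent to `F`. The Killing equation on lifts
of two fields of `F` involves no time component and does not differentiate `V` in `t`, so every
slice `V(t, ·)` is Killing on `F` (`isKillingField_spaceSlice`) and vanishes by hypothesis. With `V
= 0`, testing on `(∂_t, ∂_t)` gives `f² ∂_t h = 0`, and testing on `∂_t` and a lift of `Y` gives `f²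
Y h = 0`. Since `f > 0` and smooth fields take every value at a point, `dh = 0`
(`mfderiv_timePart_eq_zero`), and `h` is constant by connectedness. Conversely, the metric
coefficients do not depend on `t`, so `c ∂_t` acts on `g(Y, Z)` by differentiating the coordinates
of `Y` and `Z` alone, and these terms are the brackets with `c ∂_t`. Brackets are computed in the
preferred chart at the point itself, whose differential there is the identity. -/

open scoped Topology

noncomputable section

/-! ### Vector fields and Lie brackets in the preferred chart -/

section Coordinates

variable {E : Type*} [NormedAddCommGroup E] [NormedSpace ℝ E]
  {H : Type*} [TopologicalSpace H] (I : ModelWithCorners ℝ E H)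
  {N : Type*} [TopologicalSpace N] [ChartedSpace H N]

/-- The coordinate expression of the vector field `X` in the preferred chart at `x₀`. -/
def coordField (X : ∀ x : N, TangentSpace I x) (x₀ : N) (e : E) : E :=
  mfderiv I 𝓘(ℝ, E) (extChartAt I x₀) ((extChartAt I x₀).symm e) (X ((extChartAt I x₀).symm e))

theorem coordField_self [IsManifold I 1 N] (X : ∀ x : N, TangentSpace I x) (x₀ : N) :
    coordField I X x₀ (extChartAt I x₀ x₀) = X x₀ := by
  unfold coordField
  rw [extChartAt_to_inv]
  exact DFunLike.congr_fun (mfderiv_extChartAt_self (I := I) (x := x₀)) (X x₀)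

theorem mpullbackWithin_extChartAt_symm_eq_coordField [IsManifold I 1 N]
    (X : ∀ x : N, TangentSpace I x) (x₀ : N) {e : E} (he : e ∈ (extChartAt I x₀).target) :
    VectorField.mpullbackWithin 𝓘(ℝ, E) I (extChartAt I x₀).symm X (Set.range I) e
      = coordField I X x₀ e := by
  refine ((isInvertible_mfderivWithin_extChartAt_symm he).inverse_apply_eq
    (y := X ((extChartAt I x₀).symm e))).2 ?_
  have h := mfderivWithin_extChartAt_symm_comp_mfderiv_extChartAt (I := I) he
  exact (DFunLike.congr_fun h (X ((extChartAt I x₀).symm e))).symm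

/-- The pullback of a vector field to the model space through the preferred chart at `x₀`. -/
def chartPullback (X : ∀ x : N, TangentSpace I x) (x₀ : N) : E → E :=
  VectorField.mpullbackWithin 𝓘(ℝ, E) I (extChartAt I x₀).symm X (Set.range I)

theorem chartPullback_eventuallyEq_coordField [I.Boundaryless] [IsManifold I 1 N]
    (X : ∀ x : N, TangentSpace I x) (x₀ : N) :
    chartPullback I X x₀ =ᶠ[𝓝 (extChartAt I x₀ x₀)] coordField I X x₀ := by
  filter_upwards [extChartAt_target_mem_nhds (I := I) x₀] with e he
  exact mpullbackWithin_extChartAt_symm_eq_coordField I X x₀ he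

/-- The bracket is the Euclidean bracket of the chart expressions, transported back by the inverse
differential of the chart; at the base point that differential is the identity. -/
theorem mlieBracket_eq_coordField [I.Boundaryless] [IsManifold I 1 N]
    (X Y : ∀ x : N, TangentSpace I x) (x₀ : N) :
    (VectorField.mlieBracket I X Y x₀ : E)
      = fderiv ℝ (coordField I Y x₀) (extChartAt I x₀ x₀) (X x₀)
        - fderiv ℝ (coordField I X x₀) (extChartAt I x₀ x₀) (Y x₀) := by
  let D : E →L[ℝ] E := mfderiv I 𝓘(ℝ, E) (extChartAt I x₀) x₀
  have h1 : VectorField.mlieBracket I X Y x₀ = D.inverse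
      (VectorField.lieBracketWithin (E := E) ℝ (chartPullback I X x₀) (chartPullback I Y x₀)
        ((extChartAt I x₀).symm ⁻¹' Set.univ ∩ Set.range I) (extChartAt I x₀ x₀)) := rfl
  have h2 : D.inverse = ContinuousLinearMap.id ℝ E := by
    have h3 : D = ContinuousLinearMap.id ℝ E := mfderiv_extChartAt_self
    rw [h3]
    exact ContinuousLinearMap.inverse_id
  rw [h1, h2, Set.preimage_univ, Set.univ_inter, I.range_eq_univ,
    VectorField.lieBracketWithin_univ]
  have hX := chartPullback_eventuallyEq_coordField I X x₀
  have hY := chartPullback_eventuallyEq_coordField I Y x₀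
  refine (hX.lieBracket_vectorField_eq hY).trans ?_
  rw [← coordField_self I X, ← coordField_self I Y]
  rfl

theorem IsSmoothVectorField.differentiableAt_coordField [CompleteSpace E] [I.Boundaryless]
    [IsManifold I ∞ N]
    {X : ∀ x : N, TangentSpace I x} (hX : IsSmoothVectorField I X) (x₀ : N) :
    DifferentiableAt ℝ (coordField I X x₀) (extChartAt I x₀ x₀) := by
  have : IsManifold I 2 N := IsManifold.of_le (n := ∞) (by norm_cast)
  have h : MDifferentiableWithinAt I I.tangent (fun x => (⟨x, X x⟩ : TangentBundle I N))
      Set.univ x₀ := (hX.mdifferentiable (by simp) x₀).mdifferentiableWithinAt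
  have h' : DifferentiableWithinAt ℝ (chartPullback I X x₀)
    ((extChartAt I x₀).symm ⁻¹' Set.univ ∩ Set.range I) (extChartAt I x₀ x₀) :=
    h.differentiableWithinAt_mpullbackWithin_vectorField
  rw [Set.preimage_univ, Set.univ_inter, I.range_eq_univ, differentiableWithinAt_univ] at h'
  exact h'.congr_of_eventuallyEq (chartPullback_eventuallyEq_coordField I X x₀).symm

/-- A real function on a preconnected manifold without boundary whose differential vanishes is
constant. -/
theorem eq_of_mfderiv_eq_zero [I.Boundaryless] [IsManifold I 1 N] [PreconnectedSpace N]
    {h : N → ℝ}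
    (hd : MDifferentiable I 𝓘(ℝ, ℝ) h) (h0 : ∀ x, mfderiv I 𝓘(ℝ, ℝ) h x = 0) (x y : N) :
    h x = h y := by
  have hloc : IsLocallyConstant h := by
    rw [IsLocallyConstant.iff_eventually_eq]
    intro x₀
    -- A ball inside the chart target is convex, so a vanishing derivative forces constancy on it.
    obtain ⟨r, hr, hball⟩ := Metric.mem_nhds_iff.1 (extChartAt_target_mem_nhds (I := I) x₀)
    have hder : ∀ e ∈ Metric.ball (extChartAt I x₀ x₀) r,
        HasFDerivAt (h ∘ (extChartAt I x₀).symm) (0 : E →L[ℝ] ℝ) e := by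
      intro e he
      have h1 : HasMFDerivAt 𝓘(ℝ, E) I (extChartAt I x₀).symm e _ :=
        ((mdifferentiableOn_extChartAt_symm (I := I) (x := x₀)).mdifferentiableAt
          ((isOpen_extChartAt_target x₀).mem_nhds (hball he))).hasMFDerivAt
      have h2 := (hd ((extChartAt I x₀).symm e)).hasMFDerivAt
      rw [h0] at h2
      have h3 := (h2.comp e h1).hasFDerivAt
      exact h3.congr_fderiv (by ext v; rfl)
    have hpre : extChartAt I x₀ ⁻¹' Metric.ball (extChartAt I x₀ x₀) r ∈ 𝓝 x₀ :=
      (continuousAt_extChartAt x₀).preimage_mem_nhds (Metric.ball_mem_nhds _ hr)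
    filter_upwards [hpre, extChartAt_source_mem_nhds (I := I) x₀] with z hz hzs
    have hc := (convex_ball (extChartAt I x₀ x₀) r).is_const_of_fderivWithin_eq_zero (𝕜 := ℝ)
      (f := h ∘ (extChartAt I x₀).symm)
      (fun e he => (hder e he).differentiableAt.differentiableWithinAt)
      (fun e he => by
        rw [fderivWithin_of_isOpen Metric.isOpen_ball he]
        exact (hder e he).fderiv)
      hz (Metric.mem_ball_self hr)
    rwa [Function.comp_apply, Function.comp_apply, (extChartAt I x₀).left_inv hzs,
      extChartAt_to_inv] at hc
  exact hloc.apply_eq_of_preconnectedSpace x y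

end Coordinates

/-! ### Coordinates and brackets on the product `J × F` -/

section ProductCoordinates

variable {s : ℕ} {F : Type*} [TopologicalSpace F] [ChartedSpace (EuclideanSpace ℝ (Fin s)) F]
  {J : TopologicalSpace.Opens ℝ}

/-- The time component of a vector field on `J × F`. -/
def timePart (X : ∀ p : J × F, TangentSpace (staticModel s) p) (p : J × F) : ℝ :=
  Prod.fst (α := ℝ) (β := EuclideanSpace ℝ (Fin s)) (X p)

/-- The component along `F` of a vector field on `J × F`. -/
def spacePart (X : ∀ p : J × F, TangentSpace (staticModel s) p) (p : J × F) :
    TangentSpace (𝓡 s) p.2 :=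
  Prod.snd (α := ℝ) (β := EuclideanSpace ℝ (Fin s)) (X p)

/-- The restriction of the component along `F` of a vector field on `J × F` to `{t} × F`. -/
def spaceSlice (X : ∀ p : J × F, TangentSpace (staticModel s) p) (t : J) (x : F) :
    TangentSpace (𝓡 s) x :=
  spacePart X (t, x)

/-- The lift to `J × F` of a vector field on `F`. -/
def liftField (J : TopologicalSpace.Opens ℝ) (Y : ∀ x : F, TangentSpace (𝓡 s) x) (p : J × F) :
    TangentSpace (staticModel s) p :=
  ((0 : ℝ), (Y p.2 : EuclideanSpace ℝ (Fin s)))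

theorem extChartAt_staticModel_symm_fst {p₀ : J × F} {e : ℝ × EuclideanSpace ℝ (Fin s)}
    (he : e ∈ (extChartAt (staticModel s) p₀).target) :
    (((extChartAt (staticModel s) p₀).symm e).1 : ℝ) = e.1 :=
  congrArg Prod.fst ((extChartAt (staticModel s) p₀).right_inv he)

variable [IsManifold (𝓡 s) ∞ F]

/-- The product chart is the inclusion of `J` in `ℝ` times a chart of `F`, so its differential is
block diagonal with the identity in the time block. -/
theorem coordField_staticModel (X : ∀ p : J × F, TangentSpace (staticModel s) p) (p₀ : J × F)
    {e : ℝ × EuclideanSpace ℝ (Fin s)} (he : e ∈ (extChartAt (staticModel s) p₀).target) :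
    coordField (staticModel s) X p₀ e = (timePart X ((extChartAt (staticModel s) p₀).symm e),
      mfderiv (𝓡 s) 𝓘(ℝ, EuclideanSpace ℝ (Fin s)) (extChartAt (𝓡 s) p₀.2)
        ((extChartAt (staticModel s) p₀).symm e).2
        (spacePart X ((extChartAt (staticModel s) p₀).symm e))) := by
  have hs := (extChartAt (staticModel s) p₀).map_target he
  unfold coordField
  generalize (extChartAt (staticModel s) p₀).symm e = p at hs ⊢
  rw [extChartAt_prod] at hs
  have h1 : HasMFDerivAt 𝓘(ℝ, ℝ) 𝓘(ℝ, ℝ) (extChartAt 𝓘(ℝ, ℝ) p₀.1) p.1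
    (ContinuousLinearMap.id ℝ ℝ) := hasMFDerivAt_opens_coe J p.1
  have h2 : MDifferentiableAt (𝓡 s) 𝓘(ℝ, EuclideanSpace ℝ (Fin s)) (extChartAt (𝓡 s) p₀.2) p.2 :=
    mdifferentiableAt_extChartAt (by simpa using hs.2)
  have h3 := h1.comp p (hasMFDerivAt_fst (I := 𝓘(ℝ, ℝ)) (I' := 𝓡 s) (x := p))
  have h4 := h2.hasMFDerivAt.comp p (hasMFDerivAt_snd (I := 𝓘(ℝ, ℝ)) (I' := 𝓡 s) (x := p))
  have h5 : HasMFDerivAt (staticModel s) 𝓘(ℝ, ℝ × EuclideanSpace ℝ (Fin s))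
      (extChartAt (staticModel s) p₀) p (ContinuousLinearMap.prod _ _) :=
    ⟨h3.1.prodMk h4.1, h3.2.prodMk h4.2⟩
  rw [h5.mfderiv]
  rfl

theorem coordField_staticModel_const (c : ℝ) (p₀ : J × F) :
    coordField (staticModel s) (fun p => c • staticPartialT J p) p₀
      =ᶠ[𝓝 (extChartAt (staticModel s) p₀ p₀)] fun _ => (c, 0) := by
  filter_upwards [extChartAt_target_mem_nhds (I := staticModel s) p₀] with e he
  rw [coordField_staticModel _ _ he]
  refine Prod.ext ?_ ?_
  · exact mul_one c
  · have h : spacePart (fun p : J × F => c • staticPartialT (s := s) J p) ((extChartAt (staticModel s) p₀).symm e)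
        = 0 := smul_zero c
    simp only [h, map_zero]
    rfl

theorem coordField_liftField (Y : ∀ x : F, TangentSpace (𝓡 s) x) (p₀ : J × F) :
    coordField (staticModel s) (liftField J Y) p₀
      =ᶠ[𝓝 (extChartAt (staticModel s) p₀ p₀)] fun e => (0, coordField (𝓡 s) Y p₀.2 e.2) := by
  filter_upwards [extChartAt_target_mem_nhds (I := staticModel s) p₀] with e he
  rw [coordField_staticModel _ _ he]
  rfl

theorem coordField_spaceSlice (X : ∀ p : J × F, TangentSpace (staticModel s) p) (p₀ : J × F) :
    coordField (𝓡 s) (spaceSlice X p₀.1) p₀.2 =ᶠ[𝓝 (extChartAt (𝓡 s) p₀.2 p₀.2)]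
      fun e => (coordField (staticModel s) X p₀ ((p₀.1 : ℝ), e)).2 := by
  have hc : ContinuousAt (fun e : EuclideanSpace ℝ (Fin s) => ((p₀.1 : ℝ), e))
      (extChartAt (𝓡 s) p₀.2 p₀.2) := by fun_prop
  filter_upwards [hc.preimage_mem_nhds (extChartAt_target_mem_nhds (I := staticModel s) p₀)]
    with e he
  have h1 : (extChartAt (staticModel s) p₀).symm ((p₀.1 : ℝ), e)
      = (p₀.1, (extChartAt (𝓡 s) p₀.2).symm e) :=
    Prod.ext (Subtype.ext (extChartAt_staticModel_symm_fst he)) rfl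
  rw [coordField_staticModel _ _ he, h1]
  rfl

/-- Along the line `{x₀ = const}` the coordinate expression of a field is the field itself. -/
theorem coordField_timeLine (X : ∀ p : J × F, TangentSpace (staticModel s) p) (p₀ : J × F)
    (t : J) :
    coordField (staticModel s) X p₀ ((t : ℝ), extChartAt (𝓡 s) p₀.2 p₀.2) = X (t, p₀.2) := by
  have h1 : extChartAt (staticModel s) p₀ (t, p₀.2) = ((t : ℝ), extChartAt (𝓡 s) p₀.2 p₀.2) := rfl
  have hs : (t, p₀.2) ∈ (extChartAt (staticModel s) p₀).source := by
    rw [extChartAt_prod]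
    refine ⟨?_, mem_extChartAt_source _⟩
    -- The chart of `J` is defined on all of `J`, so the time line never leaves the chart domain.
    rw [extChartAt_source, TopologicalSpace.Opens.chartAt_eq,
      OpenPartialHomeomorph.subtypeRestr_source]
    trivial
  rw [← h1, coordField_staticModel _ _ ((extChartAt (staticModel s) p₀).map_source hs),
    (extChartAt (staticModel s) p₀).left_inv hs]
  refine Prod.ext rfl ?_
  exact DFunLike.congr_fun (mfderiv_extChartAt_self (I := 𝓡 s) (x := p₀.2)) _

theorem hasMFDerivAt_timePart {X : ∀ p : J × F, TangentSpace (staticModel s) p}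
    (hX : IsSmoothVectorField (staticModel s) X) (p₀ : J × F) :
    HasMFDerivAt (staticModel s) 𝓘(ℝ, ℝ) (timePart X) p₀
      ((ContinuousLinearMap.fst ℝ ℝ (EuclideanSpace ℝ (Fin s))).comp
        (fderiv ℝ (coordField (staticModel s) X p₀) (extChartAt (staticModel s) p₀ p₀)) :
        ℝ × EuclideanSpace ℝ (Fin s) →L[ℝ] ℝ) := by
  have h1 := ((hX.differentiableAt_coordField (staticModel s) p₀).hasFDerivAt.fst).hasMFDerivAt
  have h2 : HasMFDerivAt (staticModel s) 𝓘(ℝ, ℝ × EuclideanSpace ℝ (Fin s))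
      (extChartAt (staticModel s) p₀) p₀
      (ContinuousLinearMap.id ℝ (ℝ × EuclideanSpace ℝ (Fin s))) := by
    have h := (mdifferentiableAt_extChartAt (I := staticModel s)
      (mem_chart_source _ p₀)).hasMFDerivAt
    rwa [mfderiv_extChartAt_self] at h
  have h3 := HasMFDerivAt.comp p₀ h1 h2
  refine (h3.congr_of_eventuallyEq ?_)
  filter_upwards [extChartAt_source_mem_nhds (I := staticModel s) p₀] with p hp
  simp only [Function.comp_apply]
  rw [coordField_staticModel _ _ ((extChartAt (staticModel s) p₀).map_source hp),
    (extChartAt (staticModel s) p₀).left_inv hp]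

/-- In coordinates the bracket is `DY·X - DX·Y`. The lift has no time component, so the second term
differentiates `X` only along `F`; the lift does not depend on `t`, so the first sees only the
`F`-component of `X`. -/
theorem mlieBracket_liftField {X : ∀ p : J × F, TangentSpace (staticModel s) p}
    {Y : ∀ x : F, TangentSpace (𝓡 s) x} (hX : IsSmoothVectorField (staticModel s) X)
    (hY : IsSmoothVectorField (𝓡 s) Y) (p : J × F) :
    VectorField.mlieBracket (staticModel s) X (liftField J Y) p
      = (-mfderiv (staticModel s) 𝓘(ℝ, ℝ) (timePart X) p (liftField J Y p),
        VectorField.mlieBracket (𝓡 s) (spaceSlice X p.1) Y p.2) := by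
  have hXd := (hX.differentiableAt_coordField (staticModel s) p).hasFDerivAt
  have hYd := (hY.differentiableAt_coordField (𝓡 s) p.2).hasFDerivAt
  have hY' : HasFDerivAt (fun e : ℝ × EuclideanSpace ℝ (Fin s) => coordField (𝓡 s) Y p.2 e.2) _
      (extChartAt (staticModel s) p p) :=
    HasFDerivAt.comp (f := Prod.snd) (g := coordField (𝓡 s) Y p.2)
      (extChartAt (staticModel s) p p) hYd
      (hasFDerivAt_snd (𝕜 := ℝ) (E := ℝ) (F := EuclideanSpace ℝ (Fin s)))
  have hL : HasFDerivAt (coordField (staticModel s) (liftField J Y) p) _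
      (extChartAt (staticModel s) p p) :=
    ((hasFDerivAt_const (0 : ℝ) (extChartAt (staticModel s) p p)).prodMk
      hY').congr_of_eventuallyEq (coordField_liftField Y p)
  have hS : HasFDerivAt (coordField (𝓡 s) (spaceSlice X p.1) p.2) _ (extChartAt (𝓡 s) p.2 p.2) :=
    (HasFDerivAt.comp (extChartAt (𝓡 s) p.2 p.2) hXd.snd
      ((hasFDerivAt_const (p.1 : ℝ) _).prodMk (hasFDerivAt_id _))).congr_of_eventuallyEq
      (coordField_spaceSlice X p)
  refine (mlieBracket_eq_coordField _ X (liftField J Y) p).trans ?_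
  rw [(hasMFDerivAt_timePart hX p).mfderiv, hL.fderiv]
  refine Prod.ext ?_ ?_
  · exact zero_sub _
  · refine Eq.trans ?_ (mlieBracket_eq_coordField _ (spaceSlice X p.1) Y p.2).symm
    rw [hS.fderiv]
    rfl

/-- The field `c ∂_t` has constant coordinates, so only one term of the bracket survives. -/
theorem mlieBracket_const_smul_partialT (c : ℝ) (X : ∀ p : J × F, TangentSpace (staticModel s) p)
    (p : J × F) :
    VectorField.mlieBracket (staticModel s) (fun p => c • staticPartialT J p) X p
      = fderiv ℝ (coordField (staticModel s) X p) (extChartAt (staticModel s) p p) (c, 0) := by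
  refine (mlieBracket_eq_coordField _ _ X p).trans ?_
  rw [(coordField_staticModel_const c p).fderiv_eq]
  have h : (c • staticPartialT J p : TangentSpace (staticModel s) p)
      = ((c, 0) : ℝ × EuclideanSpace ℝ (Fin s)) := Prod.ext (mul_one c) (smul_zero c)
  rw [h, fderiv_fun_const]
  exact sub_zero _

end ProductCoordinates

/-! ### Smoothness of lifts, slices and metric products -/

section Smoothness

/-- The tangent bundle trivialization at `x₀` is the differential of the chart, so the coordinate
expression is the section read in that trivialization. -/
theorem isSmoothVectorField_of_coordField {E : Type*} [NormedAddCommGroup E] [NormedSpace ℝ E]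
    {H : Type*} [TopologicalSpace H] (I : ModelWithCorners ℝ E H)
    {N : Type*} [TopologicalSpace N] [ChartedSpace H N] [IsManifold I ∞ N]
    {X : ∀ x : N, TangentSpace I x}
    (h : ∀ x₀ : N, ContMDiffAt I 𝓘(ℝ, E) ∞ (fun x => coordField I X x₀ (extChartAt I x₀ x)) x₀) :
    IsSmoothVectorField I X := by
  intro x₀
  rw [Bundle.contMDiffAt_section]
  refine (h x₀).congr_of_eventuallyEq ?_
  filter_upwards [chart_source_mem_nhds H x₀] with x hx
  unfold coordField
  rw [(extChartAt I x₀).left_inv (by rwa [extChartAt_source]),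
    ← TangentBundle.continuousLinearMapAt_trivializationAt hx]
  exact (Bundle.Trivialization.continuousLinearMapAt_apply_of_mem _ (R := ℝ) hx _).symm

variable {s : ℕ} {F : Type*} [TopologicalSpace F] [ChartedSpace (EuclideanSpace ℝ (Fin s)) F]
  [IsManifold (𝓡 s) ∞ F] {J : TopologicalSpace.Opens ℝ}

theorem isSmoothVectorField_const_smul_partialT (J : TopologicalSpace.Opens ℝ) (c : ℝ) :
    IsSmoothVectorField (staticModel s) (fun p : J × F => c • staticPartialT J p) := by
  refine isSmoothVectorField_of_coordField _ fun p₀ => ?_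
  refine (contMDiffAt_const (c := ((c, 0) : ℝ × EuclideanSpace ℝ (Fin s)))).congr_of_eventuallyEq ?_
  exact (continuousAt_extChartAt p₀).eventually (coordField_staticModel_const c p₀)

theorem isSmoothVectorField_liftField {Y : ∀ x : F, TangentSpace (𝓡 s) x}
    (hY : IsSmoothVectorField (𝓡 s) Y) :
    IsSmoothVectorField (staticModel s) (liftField J Y) := by
  have h1 : ContMDiff (staticModel s) (𝓘(ℝ, ℝ).tangent) ∞
      (fun p : J × F => (⟨p.1, 0⟩ : TangentBundle 𝓘(ℝ, ℝ) J)) :=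
    (Bundle.contMDiff_zeroSection ℝ (TangentSpace 𝓘(ℝ, ℝ) : J → Type _)).comp contMDiff_fst
  have h2 : ContMDiff (staticModel s) ((𝓡 s).tangent) ∞
      (fun p : J × F => (⟨p.2, Y p.2⟩ : TangentBundle (𝓡 s) F)) := hY.comp contMDiff_snd
  exact contMDiff_equivTangentBundleProd_symm.comp (h1.prodMk h2)

theorem contMDiff_spacePart {X : ∀ p : J × F, TangentSpace (staticModel s) p}
    (hX : IsSmoothVectorField (staticModel s) X) :
    ContMDiff (staticModel s) (𝓡 s).tangent ∞
      (fun p => (⟨p.2, spacePart X p⟩ : TangentBundle (𝓡 s) F)) :=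
  contMDiff_snd.comp (contMDiff_equivTangentBundleProd.comp hX)

theorem isSmoothVectorField_spaceSlice {X : ∀ p : J × F, TangentSpace (staticModel s) p}
    (hX : IsSmoothVectorField (staticModel s) X) (t : J) :
    IsSmoothVectorField (𝓡 s) (spaceSlice X t) :=
  (contMDiff_spacePart hX).comp (contMDiff_const.prodMk contMDiff_id)

theorem contMDiff_metric_apply {EM : Type*} [NormedAddCommGroup EM] [NormedSpace ℝ EM]
    {HM : Type*} [TopologicalSpace HM] {IM : ModelWithCorners ℝ EM HM}
    {M : Type*} [TopologicalSpace M] [ChartedSpace HM M]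
    (gF : Bundle.ContMDiffRiemannianMetric (𝓡 s) ∞ (EuclideanSpace ℝ (Fin s))
      (fun x : F => TangentSpace (𝓡 s) x))
    {b : M → F} {v w : ∀ m, TangentSpace (𝓡 s) (b m)}
    (hv : ContMDiff IM (𝓡 s).tangent ∞ (fun m => (⟨b m, v m⟩ : TangentBundle (𝓡 s) F)))
    (hw : ContMDiff IM (𝓡 s).tangent ∞ (fun m => (⟨b m, w m⟩ : TangentBundle (𝓡 s) F))) :
    ContMDiff IM 𝓘(ℝ, ℝ) ∞ (fun m => gF.inner (b m) (v m) (w m)) := by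
  have hb : ContMDiff IM (𝓡 s) ∞ b := by
    have := (Bundle.contMDiff_proj (TangentSpace (𝓡 s) : F → Type _) (n := ∞)
      (IB := 𝓡 s) (F := EuclideanSpace ℝ (Fin s))).comp hv
    exact this
  intro x
  have : ContMDiffAt IM ((𝓡 s).prod 𝓘(ℝ)) ∞
      (fun m ↦ Bundle.TotalSpace.mk' ℝ (E := Bundle.Trivial F ℝ) (b m)
        (gF.inner (b m) (v m) (w m))) x := by
    apply ContMDiffAt.clm_bundle_apply₂ (F₁ := EuclideanSpace ℝ (Fin s))
      (F₂ := EuclideanSpace ℝ (Fin s))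
    · exact (gF.contMDiff _).comp x (hb x)
    · exact hv x
    · exact hw x
  simp only [Bundle.contMDiffAt_totalSpace] at this
  exact this.2

/-- A local smooth extension of `v` is cut off by a bump function equal to `1` at `x`. This lets
identities for test fields be read as identities for tangent vectors. -/
theorem exists_isSmoothVectorField_eq [T2Space F] (x : F) (v : TangentSpace (𝓡 s) x) :
    ∃ Y : ∀ x : F, TangentSpace (𝓡 s) x, IsSmoothVectorField (𝓡 s) Y ∧ Y x = v := by
  obtain ⟨u, hu, hs⟩ := FiberBundle.exists_contMDiffOn_extend (k := ∞) (𝓡 s)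
    (EuclideanSpace ℝ (Fin s)) v
  obtain ⟨o, hou, ho, hxo⟩ := mem_nhds_iff.1 hu
  obtain ⟨ψ, -, hψ⟩ := (SmoothBumpFunction.nhds_basis_tsupport (I := 𝓡 s) x).mem_iff.1
    (ho.mem_nhds hxo)
  refine ⟨(ψ : F → ℝ) • FiberBundle.extend (EuclideanSpace ℝ (Fin s)) v,
    ContMDiffOn.smul_section_of_tsupport ψ.contMDiff.contMDiffOn ho hψ (hs.mono hou), ?_⟩
  rw [Pi.smul_apply', ψ.eq_one, one_smul]
  simp

end Smoothness

/-! ### The Killing equation of the static metric -/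

section KillingFields

variable {s : ℕ} {F : Type*} [TopologicalSpace F] [ChartedSpace (EuclideanSpace ℝ (Fin s)) F]
 {J : TopologicalSpace.Opens ℝ}

theorem timePart_liftField (Y : ∀ x : F, TangentSpace (𝓡 s) x) (p : J × F) :
    timePart (liftField J Y) p = 0 := rfl

theorem spacePart_liftField (Y : ∀ x : F, TangentSpace (𝓡 s) x) (p : J × F) :
    spacePart (liftField J Y) p = Y p.2 := rfl

theorem timePart_const_smul_partialT (c : ℝ) (p : J × F) :
    timePart (fun p : J × F => c • staticPartialT (s := s) J p) p = c := mul_one c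

theorem spacePart_const_smul_partialT (c : ℝ) (p : J × F) :
    spacePart (fun p : J × F => c • staticPartialT (s := s) J p) p = 0 :=
  smul_zero (A := EuclideanSpace ℝ (Fin s)) c

theorem const_smul_staticPartialT (c : ℝ) (p : J × F) :
    (c • staticPartialT J p : TangentSpace (staticModel s) p)
      = ((c, 0) : ℝ × EuclideanSpace ℝ (Fin s)) :=
  Prod.ext (mul_one c) (smul_zero (A := EuclideanSpace ℝ (Fin s)) c)

theorem eq_of_timePart_eq_of_spacePart_eq {X Y : ∀ p : J × F, TangentSpace (staticModel s) p}
    (ht : ∀ p, timePart X p = timePart Y p) (hs : ∀ p, spacePart X p = spacePart Y p) : X = Y :=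
  funext fun p => Prod.ext (ht p) (hs p)

/-- The derivative along a field of a function pulled back from `F`. -/
theorem derivAlong_comp_snd (X : ∀ p : J × F, TangentSpace (staticModel s) p) {φ : F → ℝ}
    (p : J × F) (hφ : MDifferentiableAt (𝓡 s) 𝓘(ℝ, ℝ) φ p.2) :
    derivAlong (staticModel s) X (fun q => φ q.2) p
      = mfderiv (𝓡 s) 𝓘(ℝ, ℝ) φ p.2 (spacePart X p) := by
  have h := hφ.hasMFDerivAt.comp p (hasMFDerivAt_snd (I := 𝓘(ℝ, ℝ)) (I' := 𝓡 s) (x := p))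
  unfold derivAlong
  exact DFunLike.congr_fun h.mfderiv (X p)

variable [IsManifold (𝓡 s) ∞ F]

theorem timePart_mlieBracket_liftField {X : ∀ p : J × F, TangentSpace (staticModel s) p}
    {Y : ∀ x : F, TangentSpace (𝓡 s) x} (hX : IsSmoothVectorField (staticModel s) X)
    (hY : IsSmoothVectorField (𝓡 s) Y) (p : J × F) :
    timePart (VectorField.mlieBracket (staticModel s) X (liftField J Y)) p
      = -derivAlong (staticModel s) (liftField J Y) (timePart X) p :=
  congrArg Prod.fst (mlieBracket_liftField hX hY p)

theorem spacePart_mlieBracket_liftField {X : ∀ p : J × F, TangentSpace (staticModel s) p}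
    {Y : ∀ x : F, TangentSpace (𝓡 s) x} (hX : IsSmoothVectorField (staticModel s) X)
    (hY : IsSmoothVectorField (𝓡 s) Y) (p : J × F) :
    spacePart (VectorField.mlieBracket (staticModel s) X (liftField J Y)) p
      = VectorField.mlieBracket (𝓡 s) (spaceSlice X p.1) Y p.2 :=
  congrArg Prod.snd (mlieBracket_liftField hX hY p)

theorem mlieBracket_const_smul_partialT_right (c : ℝ)
    (X : ∀ p : J × F, TangentSpace (staticModel s) p) (p : J × F) :
    (VectorField.mlieBracket (staticModel s) X (fun p => c • staticPartialT J p) p :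
      ℝ × EuclideanSpace ℝ (Fin s))
      = -fderiv ℝ (coordField (staticModel s) X p) (extChartAt (staticModel s) p p) (c, 0) :=
  (VectorField.mlieBracket_swap_apply (I := staticModel s)).trans
    (congrArg (fun v : ℝ × EuclideanSpace ℝ (Fin s) => -v) (mlieBracket_const_smul_partialT c X p))

theorem timePart_mlieBracket_const_smul_partialT {X : ∀ p : J × F, TangentSpace (staticModel s) p}
    (hX : IsSmoothVectorField (staticModel s) X) (c : ℝ) (p : J × F) :
    timePart (VectorField.mlieBracket (staticModel s) X (fun p => c • staticPartialT J p)) p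
      = -derivAlong (staticModel s) (fun p => c • staticPartialT J p) (timePart X) p := by
  refine (congrArg Prod.fst (mlieBracket_const_smul_partialT_right c X p)).trans ?_
  unfold derivAlong
  rw [(hasMFDerivAt_timePart hX p).mfderiv]
  exact congrArg (fun v : ℝ × EuclideanSpace ℝ (Fin s) => -(fderiv ℝ
    (coordField (staticModel s) X p) (extChartAt (staticModel s) p p) v).1)
    (const_smul_staticPartialT c p).symm

/-- The bracket with `c ∂_t` is minus a derivative of the coordinates of `X`, and their
`F`-component vanishes identically near the point. -/
theorem spacePart_mlieBracket_const_smul_partialT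
    {X : ∀ p : J × F, TangentSpace (staticModel s) p}
    (hX : IsSmoothVectorField (staticModel s) X) (h0 : ∀ p, spacePart X p = 0) (c : ℝ)
    (p : J × F) :
    spacePart (VectorField.mlieBracket (staticModel s) X (fun p => c • staticPartialT J p)) p
      = 0 := by
  have h1 : (fun e => (coordField (staticModel s) X p e).2)
      =ᶠ[𝓝 (extChartAt (staticModel s) p p)] fun _ => 0 := by
    filter_upwards [extChartAt_target_mem_nhds (I := staticModel s) p] with e he
    rw [coordField_staticModel _ _ he]
    simp only [h0, map_zero]
    rfl
  have h2 := (hX.differentiableAt_coordField (staticModel s) p).hasFDerivAt.snd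
  have h3 := h2.unique ((hasFDerivAt_const _ _).congr_of_eventuallyEq h1)
  refine (congrArg Prod.snd (mlieBracket_const_smul_partialT_right c X p)).trans ?_
  have h4 := DFunLike.congr_fun h3 (c, 0)
  exact neg_eq_zero.2 h4

variable {f : F → ℝ}
  {gF : Bundle.ContMDiffRiemannianMetric (𝓡 s) ∞ (EuclideanSpace ℝ (Fin s))
      (fun x : F => TangentSpace (𝓡 s) x)}
  {K : ∀ p : J × F, TangentSpace (staticModel s) p}

theorem staticMetric_eq (p : J × F) (u v : TangentSpace (staticModel s) p) :
    staticMetric J f gF p u v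
      = -(f p.2) ^ 2 * (Prod.fst (α := ℝ) (β := EuclideanSpace ℝ (Fin s)) u
          * Prod.fst (α := ℝ) (β := EuclideanSpace ℝ (Fin s)) v)
        + gF.inner p.2 (Prod.snd (α := ℝ) (β := EuclideanSpace ℝ (Fin s)) u)
          (Prod.snd (α := ℝ) (β := EuclideanSpace ℝ (Fin s)) v) := by
  rw [staticMetric_apply, staticDt_apply, staticDt_apply, staticDproj_apply, staticDproj_apply]

theorem staticMetric_eq_parts (X Y : ∀ p : J × F, TangentSpace (staticModel s) p) (p : J × F) :
    staticMetric J f gF p (X p) (Y p) = -(f p.2) ^ 2 * (timePart X p * timePart Y p)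
      + gF.inner p.2 (spacePart X p) (spacePart Y p) :=
  staticMetric_eq p (X p) (Y p)

theorem lieDerivTensor_staticMetric (X Y Z : ∀ p : J × F, TangentSpace (staticModel s) p)
    (p : J × F) :
    lieDerivTensor (staticModel s) (staticMetric J f gF) X Y Z p
      = derivAlong (staticModel s) X (fun q => -(f q.2) ^ 2 * (timePart Y q * timePart Z q)
          + gF.inner q.2 (spacePart Y q) (spacePart Z q)) p
        - (-(f p.2) ^ 2 * (timePart (VectorField.mlieBracket (staticModel s) X Y) p * timePart Z p)
          + gF.inner p.2 (spacePart (VectorField.mlieBracket (staticModel s) X Y) p)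
            (spacePart Z p))
        - (-(f p.2) ^ 2 * (timePart Y p * timePart (VectorField.mlieBracket (staticModel s) X Z) p)
          + gF.inner p.2 (spacePart Y p)
            (spacePart (VectorField.mlieBracket (staticModel s) X Z) p)) := by
  unfold lieDerivTensor
  rw [staticMetric_eq_parts (VectorField.mlieBracket (staticModel s) X Y),
    staticMetric_eq_parts Y (VectorField.mlieBracket (staticModel s) X Z)]
  simp only [staticMetric_eq_parts]

/-- The `F`-component of a Killing field, at a fixed time, is a Killing field of `F`. -/
theorem isKillingField_spaceSlice
    (hK : IsKillingField (staticModel s) (staticMetric J f gF) K)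
    (t : J) : IsKillingField (𝓡 s) gF.inner (spaceSlice K t) := by
  refine ⟨isSmoothVectorField_spaceSlice hK.1 t, fun Y Z hY hZ x => ?_⟩
  have h := hK.2 (liftField J Y) (liftField J Z) (isSmoothVectorField_liftField hY)
    (isSmoothVectorField_liftField hZ) (t, x)
  have h2 := (contMDiff_metric_apply gF hY hZ).mdifferentiable (by simp) x
  rw [lieDerivTensor_staticMetric] at h
  simp only [timePart_liftField, spacePart_liftField, mul_zero, zero_mul, zero_add,
    spacePart_mlieBracket_liftField hK.1 hY, spacePart_mlieBracket_liftField hK.1 hZ] at h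
  rw [derivAlong_comp_snd K (φ := fun x => gF.inner x (Y x) (Z x)) (t, x) h2] at h
  exact h

/-- A Killing field without `F`-component has a constant `∂_t`-component. -/
theorem mfderiv_timePart_eq_zero [T2Space F]
    (hf : ContMDiff (𝓡 s) 𝓘(ℝ, ℝ) ∞ f) (hf_pos : ∀ x, 0 < f x)
    (hK : IsKillingField (staticModel s) (staticMetric J f gF) K) (h0 : ∀ p, spacePart K p = 0)
    (p : J × F) : mfderiv (staticModel s) 𝓘(ℝ, ℝ) (timePart K) p = 0 := by
  have hfp : f p.2 ^ 2 ≠ 0 := pow_ne_zero 2 (hf_pos _).ne'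
  -- The field `∂_t` is written `1 • ∂_t` so that the lemmas on `c • ∂_t` apply to it.
  have hT := isSmoothVectorField_const_smul_partialT (s := s) (F := F) J 1
  have hKs : ∀ φ : F → ℝ, MDifferentiableAt (𝓡 s) 𝓘(ℝ, ℝ) φ p.2 →
      derivAlong (staticModel s) K (fun q => φ q.2) p = 0 := by
    intro φ hφ
    rw [derivAlong_comp_snd K p hφ, h0]
    exact map_zero _
  have htime : derivAlong (staticModel s) (fun p => (1 : ℝ) • staticPartialT J p)
      (timePart K) p = 0 := by
    have h := hK.2 _ _ hT hT p
    rw [lieDerivTensor_staticMetric] at h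
    simp only [timePart_const_smul_partialT, spacePart_const_smul_partialT,
      spacePart_mlieBracket_const_smul_partialT hK.1 h0,
      timePart_mlieBracket_const_smul_partialT hK.1, map_zero, add_zero, mul_one, one_mul] at h
    -- Here `g(∂_t, ∂_t) = -f²` is pulled back from `F`, and `K` has no component along `F`.
    rw [hKs (fun x => -(f x) ^ 2) (((hf.pow 2).neg).mdifferentiable (by simp) p.2)] at h
    have h' : f p.2 ^ 2 * derivAlong (staticModel s) (fun p => (1 : ℝ) • staticPartialT J p)
      (timePart K) p = 0 := by linarith
    exact (mul_eq_zero.1 h').resolve_left hfp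
  have hspace : ∀ Y, IsSmoothVectorField (𝓡 s) Y →
      derivAlong (staticModel s) (liftField J Y) (timePart K) p = 0 := by
    intro Y hY
    have h := hK.2 _ _ hT (isSmoothVectorField_liftField hY) p
    rw [lieDerivTensor_staticMetric] at h
    simp only [timePart_const_smul_partialT, spacePart_const_smul_partialT, timePart_liftField,
      spacePart_mlieBracket_const_smul_partialT hK.1 h0, timePart_mlieBracket_liftField hK.1 hY,
      map_zero, _root_.zero_apply, add_zero, mul_zero, one_mul] at h
    -- Lifts are orthogonal to `∂_t`, so the function being differentiated is zero.
    rw [hKs (fun x => 0) mdifferentiableAt_const] at h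
    have h' : f p.2 ^ 2 * derivAlong (staticModel s) (liftField J Y) (timePart K) p = 0 := by
      linarith
    exact (mul_eq_zero.1 h').resolve_left hfp
  let D : ℝ × EuclideanSpace ℝ (Fin s) →L[ℝ] ℝ :=
    mfderiv (staticModel s) 𝓘(ℝ, ℝ) (timePart K) p
  suffices D = 0 from this
  refine ContinuousLinearMap.ext fun w => ?_
  obtain ⟨a, v⟩ := w
  obtain ⟨Y, hY, hYv⟩ := exists_isSmoothVectorField_eq p.2 v
  have h1 : D (1, 0) = 0 :=
    (congrArg D (const_smul_staticPartialT 1 p).symm).trans htime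
  have h2 : D (0, v) = 0 := by
    have h := hspace Y hY
    unfold derivAlong liftField at h
    rw [hYv] at h
    exact h
  have h3 : ((a, v) : ℝ × EuclideanSpace ℝ (Fin s)) = a • (1, 0) + (0, v) := by simp
  rw [h3, map_add, map_smul, h1, h2]
  simp

theorem mdifferentiable_timePart {X : ∀ p : J × F, TangentSpace (staticModel s) p}
    (hX : IsSmoothVectorField (staticModel s) X) :
    MDifferentiable (staticModel s) 𝓘(ℝ, ℝ) (timePart X) :=
  fun p => (hasMFDerivAt_timePart hX p).mdifferentiableAt

/-- The derivative along `c ∂_t` of the metric product of two fields. -/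
theorem derivAlong_const_smul_partialT (hf : ContMDiff (𝓡 s) 𝓘(ℝ, ℝ) ∞ f) (c : ℝ)
    {Y Z : ∀ p : J × F, TangentSpace (staticModel s) p}
    (hY : IsSmoothVectorField (staticModel s) Y) (hZ : IsSmoothVectorField (staticModel s) Z)
    (p : J × F) :
    derivAlong (staticModel s) (fun p => c • staticPartialT J p)
      (fun q => staticMetric J f gF q (Y q) (Z q)) p
      = staticMetric J f gF p
          (fderiv ℝ (coordField (staticModel s) Y p) (extChartAt (staticModel s) p p) (c, 0)) (Z p)
        + staticMetric J f gF p (Y p)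
          (fderiv ℝ (coordField (staticModel s) Z p) (extChartAt (staticModel s) p p)
            (c, 0)) := by
  let e := extChartAt (staticModel s) p p
  let AY : ℝ × EuclideanSpace ℝ (Fin s) →L[ℝ] ℝ × EuclideanSpace ℝ (Fin s) :=
    fderiv ℝ (coordField (staticModel s) Y p) e
  let AZ : ℝ × EuclideanSpace ℝ (Fin s) →L[ℝ] ℝ × EuclideanSpace ℝ (Fin s) :=
    fderiv ℝ (coordField (staticModel s) Z p) e
  let B : ℝ × EuclideanSpace ℝ (Fin s) →L[ℝ] ℝ × EuclideanSpace ℝ (Fin s) →L[ℝ] ℝ :=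
    staticMetric J f gF p
  let G : J × F → ℝ := fun q => staticMetric J f gF q (Y q) (Z q)
  have hG : MDifferentiableAt (staticModel s) 𝓘(ℝ, ℝ) G p := by
    have h1 : MDifferentiableAt (staticModel s) 𝓘(ℝ, ℝ) (fun q : J × F => -(f q.2) ^ 2) p :=
      ((hf.pow 2).neg.comp contMDiff_snd).mdifferentiable (by simp) p
    have h2 := (mdifferentiable_timePart hY p).mul (mdifferentiable_timePart hZ p)
    have h3 := (contMDiff_metric_apply gF (contMDiff_spacePart hY)
      (contMDiff_spacePart hZ)).mdifferentiable (by simp) p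
    have h4 : G = fun q => -(f q.2) ^ 2 * (timePart Y q * timePart Z q)
        + gF.inner q.2 (spacePart Y q) (spacePart Z q) :=
      funext fun q => staticMetric_eq_parts Y Z q
    rw [h4]
    exact (h1.mul h2).add h3
  -- The form `B` is frozen at `p`: along the time line the metric does not change, so `G`
  -- restricted to it is a fixed bilinear form in the coordinates of `Y` and `Z`.
  let γ : ℝ → ℝ := fun τ => B (coordField (staticModel s) Y p (τ, e.2))
    (coordField (staticModel s) Z p (τ, e.2))
  have hγ : (fun z : J => G (z, p.2)) = γ ∘ (fun z : J => (z : ℝ)) := by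
    funext z
    have hYz : coordField (staticModel s) Y p ((z : ℝ), e.2) = Y (z, p.2) :=
      coordField_timeLine Y p z
    have hZz : coordField (staticModel s) Z p ((z : ℝ), e.2) = Z (z, p.2) :=
      coordField_timeLine Z p z
    simp only [Function.comp_apply, γ, hYz, hZz, G, B]
    exact (staticMetric_eq (z, p.2) _ _).trans (staticMetric_eq p _ _).symm
  have hℓ : HasFDerivAt (fun τ : ℝ => (τ, e.2))
      (ContinuousLinearMap.inl ℝ ℝ (EuclideanSpace ℝ (Fin s))) (p.1 : ℝ) :=
    (hasFDerivAt_id _).prodMk (hasFDerivAt_const _ _)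
  have hcY : HasFDerivAt (fun τ : ℝ => coordField (staticModel s) Y p (τ, e.2))
      (AY.comp (ContinuousLinearMap.inl ℝ ℝ (EuclideanSpace ℝ (Fin s)))) (p.1 : ℝ) :=
    HasFDerivAt.comp (g := coordField (staticModel s) Y p) (p.1 : ℝ)
      (hY.differentiableAt_coordField (staticModel s) p).hasFDerivAt hℓ
  have hcZ : HasFDerivAt (fun τ : ℝ => coordField (staticModel s) Z p (τ, e.2))
      (AZ.comp (ContinuousLinearMap.inl ℝ ℝ (EuclideanSpace ℝ (Fin s)))) (p.1 : ℝ) :=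
    HasFDerivAt.comp (g := coordField (staticModel s) Z p) (p.1 : ℝ)
      (hZ.differentiableAt_coordField (staticModel s) p).hasFDerivAt hℓ
  have hγ' : HasFDerivAt γ _ (p.1 : ℝ) := B.hasFDerivAt_of_bilinear hcY hcZ
  have hder := (hγ'.hasMFDerivAt.comp p.1 (hasMFDerivAt_opens_coe J p.1)).mfderiv
  rw [← hγ] at hder
  have hself : ∀ X : ∀ p : J × F, TangentSpace (staticModel s) p,
      coordField (staticModel s) X p ((p.1 : ℝ), e.2) = X p := fun X => coordField_timeLine X p p.1
  have h1 : derivAlong (staticModel s) (fun p => c • staticPartialT J p) G p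
      = mfderiv (staticModel s) 𝓘(ℝ, ℝ) G p ((c, 0) : ℝ × EuclideanSpace ℝ (Fin s)) :=
    congrArg (fun v => mfderiv (staticModel s) 𝓘(ℝ, ℝ) G p v) (const_smul_staticPartialT c p)
  -- The differential of `G` splits into its two partial differentials, and `(c, 0)` has zero
  -- component along `F`.
  let D₁ : ℝ := mfderiv 𝓘(ℝ, ℝ) 𝓘(ℝ, ℝ) (fun z : J => G (z, p.2)) p.1 c
  let D₂ : ℝ := mfderiv (𝓡 s) 𝓘(ℝ, ℝ) (fun z : F => G (p.1, z)) p.2 0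
  have hD₁ : D₁ = B (coordField (staticModel s) Y p ((p.1 : ℝ), e.2)) (AZ (c, 0))
      + B (AY (c, 0)) (coordField (staticModel s) Z p ((p.1 : ℝ), e.2)) :=
    DFunLike.congr_fun hder c
  have hD₂ : D₂ = 0 := map_zero _
  have hsum : derivAlong (staticModel s) (fun p => c • staticPartialT J p) G p = D₁ + D₂ :=
    h1.trans (mfderiv_prod_eq_add_apply hG)
  refine hsum.trans ?_
  rw [hD₁, hD₂, hself, hself, add_zero, add_comm]
  rfl

theorem isKillingField_const_smul_partialT (hf : ContMDiff (𝓡 s) 𝓘(ℝ, ℝ) ∞ f) (c : ℝ) :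
    IsKillingField (staticModel s) (staticMetric J f gF)
      (fun p : J × F => c • staticPartialT J p) := by
  refine ⟨isSmoothVectorField_const_smul_partialT J c, fun Y Z hY hZ p => ?_⟩
  unfold lieDerivTensor
  rw [derivAlong_const_smul_partialT hf c hY hZ, mlieBracket_const_smul_partialT,
    mlieBracket_const_smul_partialT]
  ring

end KillingFields

instance openInterval_preconnectedSpace (t₁ t₂ : EReal) :
    PreconnectedSpace (openInterval t₁ t₂) := by
  refine Subtype.preconnectedSpace (Set.OrdConnected.isPreconnected ⟨?_⟩)
  rintro x hx y hy z hz
  exact ⟨hx.1.trans_le (EReal.coe_le_coe_iff.2 hz.1),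
    (EReal.coe_le_coe_iff.2 hz.2).trans_lt hy.2⟩

end

theorem mainTheorem7 (s : ℕ) (F : Type*) [TopologicalSpace F] [T2Space F] [ConnectedSpace F]
    [ChartedSpace (EuclideanSpace ℝ (Fin s)) F] [IsManifold (𝓡 s) ∞ F]
    (gF : Bundle.ContMDiffRiemannianMetric (𝓡 s) ∞ (EuclideanSpace ℝ (Fin s))
      (fun x : F => TangentSpace (𝓡 s) x))
    (f : F → ℝ) (hf : ContMDiff (𝓡 s) 𝓘(ℝ, ℝ) ∞ f) (hf_pos : ∀ x, 0 < f x)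
    (t₁ t₂ : EReal) (ht : t₁ < t₂)
    (hF : ∀ V : ∀ x : F, TangentSpace (𝓡 s) x, IsKillingField (𝓡 s) gF.inner V → V = 0)
    (K : ∀ p : openInterval t₁ t₂ × F, TangentSpace (staticModel s) p) :
    IsKillingField (staticModel s) (staticMetric (openInterval t₁ t₂) f gF) K ↔
      ∃ h₀ : ℝ, K = fun p => h₀ • staticPartialT (openInterval t₁ t₂) p := by
  constructor
  · intro hK
    have h0 : ∀ p, spacePart K p = 0 := fun p =>
      congrFun (hF _ (isKillingField_spaceSlice hK p.1)) p.2
    -- The constant `h₀` is the time component of `K` at an arbitrary base point; `t₁ < t₂` provides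
    -- its time coordinate.
    obtain ⟨t₀, ht₁, ht₂⟩ := EReal.lt_iff_exists_real_btwn.1 ht
    let x₀ : F := Classical.arbitrary F
    refine ⟨timePart K (⟨t₀, ht₁, ht₂⟩, x₀), eq_of_timePart_eq_of_spacePart_eq (fun p => ?_)
      fun p => ?_⟩
    · rw [timePart_const_smul_partialT]
      exact eq_of_mfderiv_eq_zero (staticModel s) (mdifferentiable_timePart hK.1)
        (mfderiv_timePart_eq_zero hf hf_pos hK h0) _ _
    · rw [spacePart_const_smul_partialT, h0]
  · rintro ⟨h₀, rfl⟩
    exact isKillingField_const_smul_partialT hf h₀
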